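/- Let $\mathcal H$ and $\mathcal K$ be finite-dimensional complex Hilbert spaces. For positive semi-definite (PSD) operators $\omega,\tau$ on the same space, let $F(\omega,\tau)=\lVert\sqrt{\omega}\sqrt{\tau}\rVert_1^2$ be their fidelity, where $\lVert X\rVert_1=\operatorname{Tr}\sqrt{X^\dagger X}$. A state is a PSD operator of trace one, and a quantum channel is a linear, completely positive, trace-preserving map. For $\varepsilon\in[0,1)$, a state $\rho$ and a PSD operator $\sigma$ on the same space, the fidelity-based smooth min-relative entropy is $$D^{\varepsilon}_{\min,F}(\rho\Vert\sigma)=-\log_2\,\inf\bigl\{F(\widetilde\rho,\sigma)\;:\;\widetilde\rho\ge 0,\ \operatorname{Tr}\widetilde\rho\le 1,\ F(\widetilde\rho,\rho)\ge 1-\varepsilon\bigr\},$$ where $\widetilde\rho$ ranges over operators on that space and $-\log_2 0=+\infty$. **Theorem.** For every $\varepsilon\in[0,1)$, every state $\rho$ on $\mathcal H$, every PSD operator $\sigma$ on $\mathcal H$ and every quantum channel $\mathcal N$ from the operators on $\mathcal H$ to the operators on $\mathcal K$, $$D^{\varepsilon}_{\min,F}(\rho\Vert\sigma)\;\ge\;D^{\varepsilon}_{\min,F}(\mathcal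 N(\rho)\Vert\mathcal N(\sigma)).$$ -/

import Mathlib

open scoped ENNReal

namespace QInfo

noncomputable section

section Operators

variable {H : Type*} [NormedAddCommGroup H] [InnerProductSpace ℂ H] [CompleteSpace H]

/-- The trace of an operator on a (finite-dimensional) Hilbert space. -/
def opTrace (X : H →L[ℂ] H) : ℂ :=
  LinearMap.trace ℂ H (X : H →ₗ[ℂ] H)

/-- The trace norm `‖X‖₁ = Tr √(X† X)`. -/
def traceNorm (X : H →L[ℂ] H) : ℝ :=
  (opTrace (CFC.sqrt (star X * X))).re

/-- The fidelity `F(ω, τ) = ‖√ω √τ‖₁²` of two positive semi-definite operators. -/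
def fidelity (ω τ : H →L[ℂ] H) : ℝ :=
  traceNorm (CFC.sqrt ω * CFC.sqrt τ) ^ 2

/-- Quantum states: positive semi-definite operators (in the Loewner order) of unit trace. -/
def IsState (ρ : H →L[ℂ] H) : Prop :=
  0 ≤ ρ ∧ opTrace ρ = 1

/-- Subnormalized states: positive semi-definite operators of trace at most one. -/
def IsSubnormalizedState (ω : H →L[ℂ] H) : Prop :=
  0 ≤ ω ∧ (opTrace ω).re ≤ 1

/-- The base-two logarithm `[0, ∞] → [-∞, ∞]`, with `log₂ 0 = -∞`. -/
def extLog2 (x : ℝ≥0∞) : EReal :=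
  ENNReal.log x / ((Real.log 2 : ℝ) : EReal)

/-- The fidelity-based smooth min-relative entropy
`-log₂ inf { F(ω, σ) : ω subnormalized, F(ω, ρ) ≥ 1 - ε }`, with values in `[-∞, ∞]`. -/
def smoothFMinRelEntropy (ε : ℝ) (ρ σ : H →L[ℂ] H) : EReal :=
  -extLog2 (⨅ ω ∈ {ω : H →L[ℂ] H | IsSubnormalizedState ω ∧ 1 - ε ≤ fidelity ω ρ},
    ENNReal.ofReal (fidelity ω σ))

end Operators

/-- Quantum channels: linear, completely positive, trace-preserving maps from the operators on `H`
to the operators on `K`. -/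
structure QuantumChannel (H K : Type*)
    [NormedAddCommGroup H] [InnerProductSpace ℂ H] [CompleteSpace H]
    [NormedAddCommGroup K] [InnerProductSpace ℂ K] [CompleteSpace K]
    extends CompletelyPositiveMap (H →L[ℂ] H) (K →L[ℂ] K) where
  trace_map : ∀ X : H →L[ℂ] H, opTrace (toFun X) = opTrace X

instance {H K : Type*}
    [NormedAddCommGroup H] [InnerProductSpace ℂ H] [CompleteSpace H]
    [NormedAddCommGroup K] [InnerProductSpace ℂ K] [CompleteSpace K] :
    CoeFun (QuantumChannel H K) (fun _ => (H →L[ℂ] H) → (K →L[ℂ] K)) where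
  coe N := N.toFun

end

end QInfo

namespace QInfo

/-! ### Trace, positivity and contractions. -/

section TraceLemmas

variable {H : Type*} [NormedAddCommGroup H] [InnerProductSpace ℂ H]

/-! Every competitor `τ` for the output pair is pulled back to a competitor `ω` for the input pair
with no larger fidelity to `σ`; comparing infima then gives the inequality. Take a polar
decomposition `√τ √N(ρ) = U |√τ √N(ρ)|`, put `C = √N(ρ)⁻¹ U† √τ` with a generalized inverse, let `T`
be the image of `C` under the trace adjoint of `N`, and set `ω = T† ρ T`. All three estimates in
`exists_pullback` move `C` through `N` by `Tr (N(X) C) = Tr (X T)`. The trace bound and the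
comparison with `σ` also apply `N` to a positive 2×2 block operator, so only 2-positivity is used;
`opTrace_block_re_le` bounds the off-diagonal block of the image. -/

lemma opTrace_add (X Y : H →L[ℂ] H) : opTrace (X + Y) = opTrace X + opTrace Y := by
  simp [opTrace]

lemma opTrace_sub (X Y : H →L[ℂ] H) : opTrace (X - Y) = opTrace X - opTrace Y := by
  simp [opTrace]

lemma opTrace_mul_comm (X Y : H →L[ℂ] H) : opTrace (X * Y) = opTrace (Y * X) :=
  LinearMap.trace_mul_comm ℂ (X : H →ₗ[ℂ] H) (Y : H →ₗ[ℂ] H)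

lemma opTrace_re_nonneg {X : H →L[ℂ] H} (hX : 0 ≤ X) : 0 ≤ (opTrace X).re := by
  have h := ((ContinuousLinearMap.nonneg_iff_isPositive X).1 hX).toLinearMap.trace_nonneg
  exact (Complex.le_def.1 h).1

lemma spectrum_real_finite [FiniteDimensional ℂ H] (P : H →L[ℂ] H) : (spectrum ℝ P).Finite := by
  have h1 : (spectrum ℂ P).Finite := by
    have := Module.End.finite_spectrum (P : H →ₗ[ℂ] H)
    have e := AlgEquiv.spectrum_eq (Module.End.toContinuousLinearMap (𝕜 := ℂ) H)
      (P : H →ₗ[ℂ] H)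
    have hP : Module.End.toContinuousLinearMap (𝕜 := ℂ) H (P : H →ₗ[ℂ] H) = P := by
      ext x; rfl
    rw [hP] at e
    rwa [e]
  rw [← spectrum.preimage_algebraMap ℂ]
  exact h1.preimage (FaithfulSMul.algebraMap_injective ℝ ℂ).injOn

variable [CompleteSpace H]

lemma sqrt_mul_sqrt {a : H →L[ℂ] H} (ha : 0 ≤ a) : CFC.sqrt a * CFC.sqrt a = a :=
  CFC.sqrt_mul_sqrt_self a ha

lemma star_sqrt (a : H →L[ℂ] H) : star (CFC.sqrt a) = CFC.sqrt a :=
  (IsSelfAdjoint.of_nonneg (CFC.sqrt_nonneg a)).star_eq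

/-- A contraction has real part at most one. -/
lemma add_star_le_two {M : H →L[ℂ] H} (hM : star M * M ≤ 1) : M + star M ≤ 2 := by
  have h1 : 0 ≤ star (1 - M) * (1 - M) := star_mul_self_nonneg _
  have h2 : star (1 - M) * (1 - M) = 1 - M - star M + star M * M := by
    simp only [star_sub, star_one]; noncomm_ring
  have h3 : (2 : H →L[ℂ] H) - (M + star M)
      = star (1 - M) * (1 - M) + (1 - star M * M) := by
    rw [h2, ← one_add_one_eq_two]; noncomm_ring
  rw [← sub_nonneg, h3]
  exact add_nonneg h1 (sub_nonneg.2 hM)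

lemma star_mul_self_le_one {M : H →L[ℂ] H} (hM : ‖M‖ ≤ 1) : star M * M ≤ 1 := by
  rw [← CStarAlgebra.norm_le_one_iff_of_nonneg _ (star_mul_self_nonneg M),
    CStarRing.norm_star_mul_self]
  exact mul_le_one₀ hM (norm_nonneg _) hM

lemma norm_le_one_of_star_mul_self {M : H →L[ℂ] H} (hM : star M * M ≤ 1) : ‖M‖ ≤ 1 := by
  rw [← CStarAlgebra.norm_le_one_iff_of_nonneg _ (star_mul_self_nonneg M),
    CStarRing.norm_star_mul_self] at hM
  nlinarith [norm_nonneg M]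

/-- Congruence by the first factor: `|A X|` only depends on `A† A`. -/
lemma traceNorm_mul_congr {A B : H →L[ℂ] H} (h : star A * A = star B * B) (X : H →L[ℂ] H) :
    traceNorm (A * X) = traceNorm (B * X) := by
  have : star (A * X) * (A * X) = star (B * X) * (B * X) := by
    simp only [star_mul]
    calc star X * star A * (A * X) = star X * (star A * A) * X := by noncomm_ring
      _ = star X * (star B * B) * X := by rw [h]
      _ = _ := by noncomm_ring
  simp only [traceNorm, this]

lemma opTrace_re_mono {X Y : H →L[ℂ] H} (h : X ≤ Y) : (opTrace X).re ≤ (opTrace Y).re := by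
  have := opTrace_re_nonneg (sub_nonneg.2 h)
  rw [opTrace_sub, Complex.sub_re] at this
  linarith

lemma opTrace_mul_re_nonneg {X Q : H →L[ℂ] H} (hX : 0 ≤ X) (hQ : 0 ≤ Q) :
    0 ≤ (opTrace (X * Q)).re := by
  have h := opTrace_re_nonneg (star_left_conjugate_nonneg hX (CFC.sqrt Q))
  rwa [star_sqrt, opTrace_mul_comm, ← mul_assoc, sqrt_mul_sqrt hQ, opTrace_mul_comm] at h

lemma traceNorm_nonneg (X : H →L[ℂ] H) : 0 ≤ traceNorm X :=
  opTrace_re_nonneg (CFC.sqrt_nonneg _)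

variable [FiniteDimensional ℂ H]

lemma opTrace_star (X : H →L[ℂ] H) : opTrace (star X) = star (opTrace X) := by
  simp only [opTrace, LinearMap.trace_eq_sum_inner _ (stdOrthonormalBasis ℂ H), star_sum]
  refine Finset.sum_congr rfl fun i _ => ?_
  simp [ContinuousLinearMap.star_eq_adjoint, ContinuousLinearMap.adjoint_inner_right]

lemma opTrace_star_mul_self (X : H →L[ℂ] H) :
    opTrace (star X * X) = ∑ i, ((‖X (stdOrthonormalBasis ℂ H i)‖ ^ 2 : ℝ) : ℂ) := by
  simp only [opTrace, LinearMap.trace_eq_sum_inner _ (stdOrthonormalBasis ℂ H)]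
  refine Finset.sum_congr rfl fun i _ => ?_
  simp [ContinuousLinearMap.star_eq_adjoint, ContinuousLinearMap.adjoint_inner_right]

lemma eq_zero_of_opTrace_star_mul_self {X : H →L[ℂ] H} (h : opTrace (star X * X) = 0) :
    X = 0 := by
  rw [opTrace_star_mul_self, ← Complex.ofReal_sum, Complex.ofReal_eq_zero,
    Finset.sum_eq_zero_iff_of_nonneg (fun _ _ => by positivity)] at h
  have : (X : H →ₗ[ℂ] H) = 0 := by
    refine (stdOrthonormalBasis ℂ H).toBasis.ext fun i => ?_
    simpa using h i (Finset.mem_univ _)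
  ext x
  exact LinearMap.congr_fun this x

/-- Every linear functional on operators is represented through the trace pairing. -/
lemma exists_opTrace_mul_eq (φ : (H →L[ℂ] H) →ₗ[ℂ] ℂ) :
    ∃ T : H →L[ℂ] H, ∀ X, φ X = opTrace (X * T) := by
  let Φ : (H →L[ℂ] H) →ₗ[ℂ] Module.Dual ℂ (H →L[ℂ] H) :=
    LinearMap.mk₂ ℂ (fun T X => opTrace (X * T))
      (fun a b c => by simp only [mul_add, opTrace_add])
      (fun c a b => by simp [opTrace])
      (fun a b c => by simp only [add_mul, opTrace_add])
      (fun c a b => by simp [opTrace])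
  have hinj : Function.Injective Φ := by
    rw [injective_iff_map_eq_zero]
    intro T hT
    exact eq_zero_of_opTrace_star_mul_self (LinearMap.congr_fun hT (star T))
  have hsurj := (LinearMap.injective_iff_surjective_of_finrank_eq_finrank
    (Subspace.dual_finrank_eq (K := ℂ) (V := H →L[ℂ] H)).symm).1 hinj
  obtain ⟨T, hT⟩ := hsurj φ
  exact ⟨T, fun X => (LinearMap.congr_fun hT X).symm⟩

/-- Only the real part of `M` has to be at most one; `opTrace_block_re_le` supplies exactly this. -/
lemma opTrace_mul_re_le {M Q : H →L[ℂ] H} (hM : M + star M ≤ 2) (hQ : 0 ≤ Q) :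
    (opTrace (M * Q)).re ≤ (opTrace Q).re := by
  have h := opTrace_mul_re_nonneg (sub_nonneg.2 hM) hQ
  have hs : (opTrace (star M * Q)).re = (opTrace (M * Q)).re := by
    have : star M * Q = star (Q * M) := by
      rw [star_mul, (IsSelfAdjoint.of_nonneg hQ).star_eq]
    rw [this, opTrace_star, opTrace_mul_comm Q M]
    simp
  rw [← one_add_one_eq_two, sub_mul, add_mul, add_mul, one_mul, opTrace_sub, opTrace_add,
    opTrace_add, Complex.sub_re, Complex.add_re, Complex.add_re, hs] at h
  linarith

/-! ### Polar decompositions and trace norm duality. -/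

/-- A positive operator has a self-adjoint generalized inverse that commutes with it. -/
lemma exists_generalized_inverse {P : H →L[ℂ] H} (hP : 0 ≤ P) :
    ∃ G : H →L[ℂ] H, star G = G ∧ P * G = G * P ∧ P * G * P = P := by
  have hsa : IsSelfAdjoint P := .of_nonneg hP
  -- The spectrum is finite, so inversion with `0⁻¹ = 0` is continuous on it; `x * x⁻¹ * x = x`
  -- holds at zero too.
  have hc : ContinuousOn (fun x : ℝ => x⁻¹) (spectrum ℝ P) := (spectrum_real_finite P).continuousOn _
  have hid : cfc (fun x : ℝ => x) P = P := cfc_id' ℝ P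
  have hcomm := (cfc_commute_cfc (fun x : ℝ => x) (fun x : ℝ => x⁻¹) P).eq
  have hmul : cfc (fun x : ℝ => x) P * cfc (fun x : ℝ => x⁻¹) P * cfc (fun x : ℝ => x) P
      = cfc (fun x : ℝ => x) P := by
    rw [← cfc_mul (fun x : ℝ => x) (fun x : ℝ => x⁻¹) P continuousOn_id hc,
      ← cfc_mul (fun x : ℝ => x * x⁻¹) (fun x : ℝ => x) P (continuousOn_id.mul hc)
        continuousOn_id]
    simp only [mul_inv_mul_cancel]
  rw [hid] at hcomm hmul
  exact ⟨cfc (fun x : ℝ => x⁻¹) P, (cfc_predicate (fun x : ℝ => x⁻¹) P).star_eq, hcomm, hmul⟩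

/-- Polar decomposition of a column of operators. -/
lemma exists_polar {ι : Type*} [Fintype ι] (h : ι → H →L[ℂ] H) {Q : H →L[ℂ] H} (hQ : 0 ≤ Q)
    (hQQ : Q * Q = ∑ k, star (h k) * h k) :
    ∃ V : ι → H →L[ℂ] H, ∑ k, star (V k) * V k ≤ 1 ∧ (∀ k, h k = V k * Q) ∧
      ∑ k, star (V k) * h k = Q := by
  obtain ⟨G, hG, hc, hi⟩ := exists_generalized_inverse hQ
  have hQs : star Q = Q := (IsSelfAdjoint.of_nonneg hQ).star_eq
  have hGQQ : G * Q * Q = Q := by rw [← hc, hi]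
  have hQQG : Q * Q * G = Q := by rw [mul_assoc, hc, ← mul_assoc, hi]
  refine ⟨fun k => h k * G, ?_, ?_, ?_⟩
  · have h1 : ∑ k, star (h k * G) * (h k * G) = Q * G := by
      calc ∑ k, star (h k * G) * (h k * G) = G * (∑ k, star (h k) * h k) * G := by
            simp only [Finset.mul_sum, Finset.sum_mul, star_mul, hG, mul_assoc]
        _ = (G * Q * Q) * G := by rw [← hQQ]; noncomm_ring
        _ = Q * G := by rw [hGQQ]
    have h2 : (1 : H →L[ℂ] H) - Q * G = star (1 - Q * G) * (1 - Q * G) := by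
      have h3 : Q * G * (Q * G) = Q * G := by rw [← mul_assoc, hi]
      simp only [star_sub, star_one, star_mul, hG, hQs, ← hc]
      rw [sub_mul, mul_sub, mul_sub, h3]
      simp
    rw [h1, ← sub_nonneg, h2]
    exact star_mul_self_nonneg _
  -- The defects `h k * (1 - G * Q)` have squares summing to zero, so each vanishes.
  · have hz : ∑ k, star (h k - h k * G * Q) * (h k - h k * G * Q) = 0 := by
      calc ∑ k, star (h k - h k * G * Q) * (h k - h k * G * Q)
          = ∑ k, star (1 - G * Q) * (star (h k) * h k) * (1 - G * Q) := by
            refine Finset.sum_congr rfl fun k _ => ?_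
            simp only [star_sub, star_one, star_mul, hG, hQs]
            noncomm_ring
        _ = star (1 - G * Q) * (Q * Q) * (1 - G * Q) := by
            rw [hQQ, Finset.mul_sum, Finset.sum_mul]
        _ = star (1 - G * Q) * Q * (Q - Q * G * Q) := by noncomm_ring
        _ = 0 := by rw [hi]; simp
    rw [Finset.sum_eq_zero_iff_of_nonneg (fun _ _ => star_mul_self_nonneg _)] at hz
    intro k
    exact sub_eq_zero.1 (CStarRing.star_mul_self_eq_zero_iff _ |>.1 (hz k (Finset.mem_univ _)))
  · calc ∑ k, star (h k * G) * h k = G * (∑ k, star (h k) * h k) := by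
          simp only [Finset.mul_sum, star_mul, hG, mul_assoc]
      _ = Q := by rw [← hQQ, ← mul_assoc, hGQQ]

/-- Polar decomposition with a contraction. -/
lemma exists_contraction_polar (X : H →L[ℂ] H) :
    ∃ U : H →L[ℂ] H, ‖U‖ ≤ 1 ∧ X = U * CFC.sqrt (star X * X) ∧
      star U * X = CFC.sqrt (star X * X) := by
  obtain ⟨V, h1, h2, h3⟩ := exists_polar (fun _ : Unit => X) (CFC.sqrt_nonneg (star X * X))
    (by simp [sqrt_mul_sqrt (star_mul_self_nonneg X)])
  refine ⟨V (), norm_le_one_of_star_mul_self (by simpa using h1), h2 (), by simpa using h3⟩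

lemma exists_traceNorm_eq (X : H →L[ℂ] H) :
    ∃ U : H →L[ℂ] H, ‖U‖ ≤ 1 ∧ traceNorm X = (opTrace (U * X)).re := by
  obtain ⟨U, h1, -, h3⟩ := exists_contraction_polar X
  exact ⟨star U, by rwa [norm_star], by rw [h3, traceNorm]⟩

lemma opTrace_mul_re_le_traceNorm {K : H →L[ℂ] H} (hK : ‖K‖ ≤ 1) (X : H →L[ℂ] H) :
    (opTrace (K * X)).re ≤ traceNorm X := by
  obtain ⟨U, h1, h2, -⟩ := exists_contraction_polar X
  have hKU : ‖K * U‖ ≤ 1 :=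
    (norm_mul_le _ _).trans (mul_le_one₀ hK (norm_nonneg _) h1)
  conv_lhs => rw [h2, ← mul_assoc]
  exact opTrace_mul_re_le (add_star_le_two (star_mul_self_le_one hKU)) (CFC.sqrt_nonneg _)

lemma traceNorm_mul_le {K : H →L[ℂ] H} (hK : ‖K‖ ≤ 1) (X : H →L[ℂ] H) :
    traceNorm (K * X) ≤ traceNorm X := by
  obtain ⟨U, h1, h2⟩ := exists_traceNorm_eq (K * X)
  rw [h2, ← mul_assoc]
  exact opTrace_mul_re_le_traceNorm
    ((norm_mul_le _ _).trans (mul_le_one₀ h1 (norm_nonneg _) hK)) X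

/-- The off-diagonal block of a positive block operator is controlled by the diagonal blocks. -/
lemma opTrace_block_re_le {ι : Type*} [Fintype ι] (h₁ h₂ : ι → H →L[ℂ] H) (C : H →L[ℂ] H) :
    (opTrace ((∑ k, star (h₁ k) * h₂ k) * C)).re ≤
      traceNorm (CFC.sqrt (∑ k, star (h₂ k) * h₂ k) * C *
        CFC.sqrt (∑ k, star (h₁ k) * h₁ k)) := by
  have pos (h : ι → H →L[ℂ] H) : 0 ≤ ∑ k, star (h k) * h k :=
    Finset.sum_nonneg fun _ _ => star_mul_self_nonneg _
  set a := CFC.sqrt (∑ k, star (h₁ k) * h₁ k) with ha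
  set d := CFC.sqrt (∑ k, star (h₂ k) * h₂ k) with hd
  obtain ⟨v, hv, hv', -⟩ := exists_polar h₁ (CFC.sqrt_nonneg _) (sqrt_mul_sqrt (pos h₁))
  obtain ⟨w, hw, hw', -⟩ := exists_polar h₂ (CFC.sqrt_nonneg _) (sqrt_mul_sqrt (pos h₂))
  rw [← ha] at hv'
  rw [← hd] at hw'
  obtain ⟨U, hU, hU', -⟩ := exists_contraction_polar (d * C * a)
  set S := CFC.sqrt (star (d * C * a) * (d * C * a)) with hS
  set M := ∑ k, star (v k) * w k with hM
  have hX : ∑ k, star (h₁ k) * h₂ k = a * M * d := by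
    rw [hM, Finset.mul_sum, Finset.sum_mul]
    refine Finset.sum_congr rfl fun k _ => ?_
    rw [hv' k, hw' k, star_mul, ha, star_sqrt]
    simp only [mul_assoc]
  have htr : opTrace ((∑ k, star (h₁ k) * h₂ k) * C) = opTrace (M * U * S) := by
    rw [hX]
    calc opTrace (a * M * d * C) = opTrace (a * (M * d * C)) := by simp only [mul_assoc]
      _ = opTrace (M * (d * C * a)) := by rw [opTrace_mul_comm]; simp only [mul_assoc]
      _ = opTrace (M * U * S) := by rw [hU']; simp only [mul_assoc]
  rw [htr]
  refine opTrace_mul_re_le ?_ (CFC.sqrt_nonneg _)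
  -- Positivity of this sum bounds `M * U + star (M * U)` by two, since both columns `v` and `w` are
  -- contractive.
  have e : ∑ k, star (v k - w k * U) * (v k - w k * U)
      = ∑ k, star (v k) * v k + star U * (∑ k, star (w k) * w k) * U
        - (M * U + star (M * U)) := by
    rw [hM, star_mul, star_sum, Finset.mul_sum, Finset.mul_sum, Finset.sum_mul, Finset.sum_mul,
      ← Finset.sum_add_distrib, ← Finset.sum_add_distrib, ← Finset.sum_sub_distrib]
    refine Finset.sum_congr rfl fun k _ => ?_
    simp only [star_sub, star_mul, star_star]
    noncomm_ring
  have h0 : 0 ≤ ∑ k, star (v k - w k * U) * (v k - w k * U) := pos _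
  rw [e, sub_nonneg] at h0
  refine h0.trans ?_
  rw [← one_add_one_eq_two]
  refine add_le_add hv ?_
  have h5 := star_left_conjugate_le_conjugate hw U
  rw [mul_one] at h5
  exact h5.trans (star_mul_self_le_one hU)

end TraceLemmas

/-! ### Channels on block operators and the pull-back. -/

section Channels

variable {H K : Type*}
  [NormedAddCommGroup H] [InnerProductSpace ℂ H] [CompleteSpace H]
  [NormedAddCommGroup K] [InnerProductSpace ℂ K] [CompleteSpace K]

lemma exists_eq_star_mul_self {A : Type*} [NonUnitalCStarAlgebra A] [PartialOrder A]
    [StarOrderedRing A] {a : A} (ha : 0 ≤ a) : ∃ b, a = star b * b :=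
  CStarAlgebra.nonneg_iff_eq_star_mul_self.1 ha

/-- A channel maps positive block operators, given by a factorization, to such operators. -/
lemma QuantumChannel.exists_block_factorization (N : QuantumChannel H K)
    (g : Fin 2 → Fin 2 → H →L[ℂ] H) :
    ∃ h : Fin 2 → Fin 2 → K →L[ℂ] K, ∀ i j,
      N (∑ k, star (g k i) * g k j) = ∑ k, star (h k i) * h k j := by
  let G : CStarMatrix (Fin 2) (Fin 2) (H →L[ℂ] H) := CStarMatrix.ofMatrix (Matrix.of g)
  have h0 := N.map_cstarMatrix_nonneg' 2 (star G * G) (star_mul_self_nonneg G)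
  obtain ⟨B, hB⟩ := exists_eq_star_mul_self h0
  refine ⟨fun k i => B k i, fun i j => ?_⟩
  have h1 := congrFun (congrFun hB i) j
  simpa [CStarMatrix.mul_apply, CStarMatrix.star_apply, G] using h1

lemma QuantumChannel.map_nonneg (N : QuantumChannel H K) {X : H →L[ℂ] H} (hX : 0 ≤ X) :
    0 ≤ N X := by
  -- The half compensates for the two equal rows.
  obtain ⟨h, hh⟩ := N.exists_block_factorization (fun _ _ => CFC.sqrt ((1 / 2 : ℝ) • X))
  have h2 : ∑ _k : Fin 2, star (CFC.sqrt ((1 / 2 : ℝ) • X)) * CFC.sqrt ((1 / 2 : ℝ) • X) = X := by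
    have hp : 0 ≤ (1 / 2 : ℝ) • X := smul_nonneg (by norm_num) hX
    rw [star_sqrt, sqrt_mul_sqrt hp, Fin.sum_univ_two, ← add_smul]
    norm_num
  have h3 := hh 0 0
  rw [h2] at h3
  rw [h3]
  exact Finset.sum_nonneg fun _ _ => star_mul_self_nonneg _

variable [FiniteDimensional ℂ H] [FiniteDimensional ℂ K]

/-- The pull-back of an operator `τ` along a channel `N` with respect to `ρ`: its fidelity with `ρ`
is at least the fidelity of `τ` with `N ρ`, while its fidelity with every `σ` is at most the
fidelity of `τ` with `N σ`. -/
lemma QuantumChannel.exists_pullback (N : QuantumChannel H K) {ρ : H →L[ℂ] H} (hρ : 0 ≤ ρ)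
    {τ : K →L[ℂ] K} (hτ : 0 ≤ τ) :
    ∃ ω : H →L[ℂ] H, 0 ≤ ω ∧ (opTrace ω).re ≤ (opTrace τ).re ∧
      fidelity τ (N ρ) ≤ fidelity ω ρ ∧
      ∀ σ, 0 ≤ σ → fidelity ω σ ≤ fidelity τ (N σ) := by
  have hNρ := N.map_nonneg hρ
  set P := CFC.sqrt (N ρ) with hPdef
  have hP : 0 ≤ P := CFC.sqrt_nonneg _
  have hPs : star P = P := star_sqrt _
  have hPP : P * P = N ρ := sqrt_mul_sqrt hNρ
  obtain ⟨U, hU, -, hU'⟩ := exists_contraction_polar (CFC.sqrt τ * P)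
  obtain ⟨G, hG, hc, hi⟩ := exists_generalized_inverse hP
  set R := star U * CFC.sqrt τ with hR
  set C := G * R with hC
  have hidem : star (P * G) * (P * G) = P * G := by
    rw [star_mul, hG, hPs, ← hc, ← mul_assoc, hi]
  have hproj : star (P * G) * (P * G) ≤ 1 := by
    rw [hidem]
    have h2 : (1 : K →L[ℂ] K) - P * G = star (1 - P * G) * (1 - P * G) := by
      have h3 : star (P * G) = P * G := by rw [star_mul, hG, hPs, hc]
      rw [h3] at hidem
      simp only [star_sub, star_one, h3]
      rw [sub_mul, mul_sub, mul_sub, hidem]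
      simp
    rw [← sub_nonneg, h2]
    exact star_mul_self_nonneg _
  have hPC : P * C = P * G * R := by rw [hC, mul_assoc]
  obtain ⟨T, hT⟩ := exists_opTrace_mul_eq
    ({ toFun := fun X => opTrace (N X * C)
       map_add' := fun X Y => by
        rw [show N (X + Y) = N X + N Y from map_add N.toLinearMap X Y, add_mul, opTrace_add]
       map_smul' := fun c X => by
        rw [show N (c • X) = c • N X from map_smul N.toLinearMap c X]
        simp [opTrace] } : (H →L[ℂ] H) →ₗ[ℂ] ℂ)
  replace hT : ∀ X, opTrace (N X * C) = opTrace (X * T) := hT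
  set r := CFC.sqrt ρ with hrdef
  have hrr : r * r = ρ := sqrt_mul_sqrt hρ
  have hrs : star r = r := star_sqrt _
  have hω : 0 ≤ star (r * T) * (r * T) := star_mul_self_nonneg _
  have hfid (σ : H →L[ℂ] H) :
      traceNorm (CFC.sqrt (star (r * T) * (r * T)) * CFC.sqrt σ)
        = traceNorm (r * T * CFC.sqrt σ) := by
    refine traceNorm_mul_congr ?_ _
    rw [star_sqrt, sqrt_mul_sqrt hω]
  refine ⟨star (r * T) * (r * T), hω, ?_, ?_, fun σ hσ => ?_⟩
  -- The blocks are `ω`, `T†ρ`, `ρT`, `ρ`. Compressing the image by the column `(1, -C)` and taking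
  -- traces gives `Tr ω - 2 Tr ω + Tr (C† N(ρ) C) ≥ 0`.
  · obtain ⟨h, hh⟩ := N.exists_block_factorization ![![r * T, r], ![0, 0]]
    have h00 := hh 0 0
    have h01 := hh 0 1
    have h11 := hh 1 1
    simp only [Fin.sum_univ_two (M := H →L[ℂ] H), Matrix.cons_val_zero, Matrix.cons_val_one,
      star_zero, mul_zero, add_zero, hrs, hrr] at h00 h01 h11
    have hpos : 0 ≤ ∑ k, star (h k 0 - h k 1 * C) * (h k 0 - h k 1 * C) :=
      Finset.sum_nonneg fun _ _ => star_mul_self_nonneg _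
    have e : ∑ k, star (h k 0 - h k 1 * C) * (h k 0 - h k 1 * C)
        = ∑ k, star (h k 0) * h k 0 + star C * (∑ k, star (h k 1) * h k 1) * C
          - ((∑ k, star (h k 0) * h k 1) * C + star ((∑ k, star (h k 0) * h k 1) * C)) := by
      rw [star_mul _ C, star_sum, Finset.mul_sum, Finset.mul_sum, Finset.sum_mul, Finset.sum_mul,
        ← Finset.sum_add_distrib, ← Finset.sum_add_distrib, ← Finset.sum_sub_distrib]
      refine Finset.sum_congr rfl fun k _ => ?_
      simp only [star_sub, star_mul, star_star]
      noncomm_ring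
    rw [e, ← h00, ← h01, ← h11] at hpos
    have h2 := opTrace_re_nonneg hpos
    have h3 : star (r * T) * r * T = star (r * T) * (r * T) := mul_assoc _ _ _
    rw [opTrace_sub, opTrace_add, opTrace_add, opTrace_star, hT, N.trace_map, h3] at h2
    have h4 : (opTrace (star C * N ρ * C)).re ≤ (opTrace τ).re := by
      have h5 : star C * N ρ * C = star R * (star (P * G) * (P * G)) * R := by
        calc star C * N ρ * C = star (P * C) * (P * C) := by
              rw [star_mul P C, hPs, ← hPP]; noncomm_ring
          _ = _ := by rw [hPC, star_mul (P * G) R]; noncomm_ring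
      rw [h5]
      refine opTrace_re_mono ?_
      refine (star_left_conjugate_le_conjugate hproj R).trans ?_
      have h6 := star_left_conjugate_le_conjugate
        (star_mul_self_le_one (M := star U) (by rwa [norm_star])) (CFC.sqrt τ)
      calc star R * 1 * R = star (CFC.sqrt τ) * (star (star U) * star U) * CFC.sqrt τ := by
            rw [hR, star_mul]; noncomm_ring
        _ ≤ star (CFC.sqrt τ) * 1 * CFC.sqrt τ := h6
        _ = τ := by rw [star_sqrt, mul_one, sqrt_mul_sqrt hτ]
    simp only [Complex.sub_re, Complex.add_re, Complex.star_def, Complex.conj_re] at h2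
    linarith
  · rw [fidelity, fidelity, hfid]
    refine pow_le_pow_left₀ (traceNorm_nonneg _) ?_ 2
    -- `C` is chosen so that `Tr (ρT) = Tr (N(ρ) C)` equals this trace norm.
    have h1 : traceNorm (CFC.sqrt τ * P) = (opTrace (r * T * r)).re := by
      rw [traceNorm, ← hU', opTrace_mul_comm (r * T) r, ← mul_assoc r, hrr, ← hT, ← hPP, hC]
      congr 1
      calc opTrace (star U * (CFC.sqrt τ * P)) = opTrace (R * P) := by rw [hR, mul_assoc]
        _ = opTrace (P * G * P * R) := by rw [hi, opTrace_mul_comm]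
        _ = opTrace (P * P * (G * R)) := by
          rw [mul_assoc P G P, ← hc]; simp only [mul_assoc]
    rw [← hPdef, h1]
    have h2 := opTrace_mul_re_le_traceNorm (K := (1 : H →L[ℂ] H))
      (norm_le_one_of_star_mul_self (by simp)) (r * T * r)
    rwa [one_mul] at h2
  · rw [fidelity, fidelity, hfid]
    refine pow_le_pow_left₀ (traceNorm_nonneg _) ?_ 2
    obtain ⟨W, hW, hW'⟩ := exists_traceNorm_eq (r * T * CFC.sqrt σ)
    set s := CFC.sqrt σ with hsdef
    have hss : s * s = σ := sqrt_mul_sqrt hσ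
    have hs : star s = s := star_sqrt _
    have hD : 0 ≤ 1 - star W * W := sub_nonneg.2 (star_mul_self_le_one hW)
    -- The second row completes `r W†W r` to `ρ`, so the diagonal blocks are `σ` and `ρ` while the
    -- off-diagonal one is `s W r`.
    obtain ⟨h, hh⟩ := N.exists_block_factorization
      ![![s, W * r], ![0, CFC.sqrt (1 - star W * W) * r]]
    have h00 := hh 0 0
    have h01 := hh 0 1
    have h11 := hh 1 1
    have hg : star (W * r) * (W * r) + star (CFC.sqrt (1 - star W * W) * r) *
        (CFC.sqrt (1 - star W * W) * r) = ρ := by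
      calc _ = r * (star W * W) * r + r * (CFC.sqrt (1 - star W * W) *
              CFC.sqrt (1 - star W * W)) * r := by
            rw [star_mul, star_mul, hrs, star_sqrt]; noncomm_ring
        _ = r * r := by rw [sqrt_mul_sqrt hD]; noncomm_ring
        _ = ρ := hrr
    simp only [Fin.sum_univ_two (M := H →L[ℂ] H), Matrix.cons_val_zero, Matrix.cons_val_one,
      star_zero, mul_zero, zero_mul, add_zero, hs, hss, hg] at h00 h01 h11
    have h2 := opTrace_block_re_le (fun k => h k 0) (fun k => h k 1) C
    rw [← h00, ← h01, ← h11, hT, ← hPdef, hPC] at h2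
    have h3 : opTrace (W * (r * T * s)) = opTrace (s * (W * r) * T) := by
      calc _ = opTrace ((W * r * T) * s) := by simp only [mul_assoc]
        _ = _ := by rw [opTrace_mul_comm]; simp only [mul_assoc]
    rw [hW', h3]
    refine h2.trans ?_
    have h4 : P * G * R * CFC.sqrt (N σ) = (P * G * star U) * (CFC.sqrt τ * CFC.sqrt (N σ)) := by
      rw [hR]; simp only [mul_assoc]
    rw [h4]
    exact traceNorm_mul_le ((norm_mul_le _ _).trans (mul_le_one₀
      (norm_le_one_of_star_mul_self hproj) (norm_nonneg _) (by rwa [norm_star]))) _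

end Channels

lemma extLog2_mono : Monotone extLog2 := fun _ _ h =>
  EReal.div_le_div_right_of_nonneg
    (EReal.coe_nonneg.2 (Real.log_nonneg one_le_two)) (ENNReal.log_monotone h)

end QInfo

theorem mainTheorem1
    {H K : Type*}
    [NormedAddCommGroup H] [InnerProductSpace ℂ H] [FiniteDimensional ℂ H] [CompleteSpace H]
    [NormedAddCommGroup K] [InnerProductSpace ℂ K] [FiniteDimensional ℂ K] [CompleteSpace K]
    (ε : ℝ) (hε₀ : 0 ≤ ε) (hε₁ : ε < 1)
    (ρ σ : H →L[ℂ] H) (hρ : QInfo.IsState ρ) (hσ : 0 ≤ σ)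
    (N : QInfo.QuantumChannel H K) :
    QInfo.smoothFMinRelEntropy ε (N ρ) (N σ) ≤ QInfo.smoothFMinRelEntropy ε ρ σ := by
  refine EReal.neg_le_neg_iff.2 (QInfo.extLog2_mono (le_iInf₂ fun τ hτ => ?_))
  obtain ⟨⟨hτ0, hτ1⟩, hτε⟩ := hτ
  obtain ⟨ω, hω, htr, hfρ, hfσ⟩ := N.exists_pullback hρ.1 hτ0
  exact (iInf₂_le ω ⟨⟨hω, htr.trans hτ1⟩, hτε.trans hfρ⟩).trans
    (ENNReal.ofReal_le_ofReal (hfσ σ hσ))
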